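/- Let $\mathbb N=\{1,2,\dots\}$, let $b=(b_j)_{j\in\mathbb N}$ be a sequence of positive reals, and let $a=(a_j)_{j\in\mathbb N}$ be a non-decreasing sequence of positive reals with $a_j\to+\infty$. For $\varepsilon>0$ and $\theta\in\ell^2(\mathbb N)$ let $\mathbb P_\theta$ be the law of $Y=(Y_j)_{j\in\mathbb N}$ in the Gaussian sequence model $Y_j=b_j\theta_j+\varepsilon\,\xi_j$, where the $\xi_j$ are independent standard Gaussian random variables. Put $$\mathcal E_a=\Big\{\theta\in\ell^2(\mathbb N):\ \sum_{j\ge1}a_j^2\theta_j^2\le1\Big\},\qquad \Theta_a(r)=\{\theta\in\mathcal E_a:\ \|\theta\|\ge r\}\quad(r>0).$$ A test is a measurable function $\Psi=\Psi(Y)$ with values in $\{0,1\}$; it is an $\alpha$-level test if $\mathbb P_0(\Psi=1)\le\alpha$. The minimax separation radius for testing $H_0:\theta=0$ against $H_1:\theta\in\Theta_a(r)$ is $$\tilde r_\varepsilon=\inf_{\Psi\ \alpha\text{-level}}\ \inf\Big\{r>0:\ \sup_{\theta\in\Theta_a(r)}\mathbb P_\theta(\Psi=0)\le\beta\Big\},$$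 where the supremum over the empty set is $0$. For $\alpha,\beta\in(0,1)$ write $x_\gamma=\ln(1/\gamma)$ and $$c(\alpha,\beta)=\big(2\ln(1+4(1-\alpha-\beta)^2)\big)^{1/4},\qquad C(\alpha,\beta)=\sqrt{2x_\beta}+\sqrt{2(x_\alpha+x_\beta)}+\sqrt2\,\big(\sqrt{x_\alpha}+\sqrt{x_\beta}\big)^{1/2}.$$ Theorem. Let $\alpha,\beta\in(0,1)$. Then for every $\varepsilon>0$ $$\tilde r_\varepsilon^2\ \le\ \inf_{D\in\mathbb N}\Big[C(\alpha,\beta)^2\,\varepsilon^2\sqrt{\textstyle\sum_{j=1}^D b_j^{-4}}+a_D^{-2}\Big],$$ and, if $\alpha+\beta\le1$, $$\sup_{D\in\mathbb N}\Big[\Big(c(\alpha,\beta)^2\,\varepsilon^2\sqrt{\textstyle\sum_{j=1}^D b_j^{-4}}\Big)\wedge a_D^{-2}\Big]\ \le\ \tilde r_\varepsilon^2 .$$ -/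

import Mathlib

open MeasureTheory ProbabilityTheory Filter
open scoped lp ENNReal

namespace GaussianSequence

noncomputable section

/-- The law `P_θ` of the observation `Y = (Y_j)_{j ≥ 1}`, `Y_j = b_j θ_j + ε ξ_j`, where the `ξ_j`
are independent standard Gaussian random variables. The index set `{1, 2, …}` is `ℕ+`. -/
def law (b : ℕ+ → ℝ) (ε : ℝ) (θ : ℓ²(ℕ+, ℝ)) : Measure (ℕ+ → ℝ) :=
  (Measure.infinitePi (fun _ : ℕ+ => gaussianReal 0 1)).map (fun ξ j => b j * θ j + ε * ξ j)

/-- The ellipsoid of all `θ` in `ℓ²` with `∑ a_j² θ_j² ≤ R` (in particular the series converges). -/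
def ellipsoid (a : ℕ+ → ℝ) (R : ℝ) : Set ℓ²(ℕ+, ℝ) :=
  {θ | Summable (fun j => a j ^ 2 * θ j ^ 2) ∧ ∑' j, a j ^ 2 * θ j ^ 2 ≤ R}

/-- The alternative `Θ_a(r)`: signals of the ellipsoid with `R = 1` whose `ℓ²` norm is at
least `r`. -/
def alternative (a : ℕ+ → ℝ) (r : ℝ) : Set ℓ²(ℕ+, ℝ) :=
  {θ | θ ∈ ellipsoid a 1 ∧ r ≤ ‖θ‖}

/-- First kind error probability of the test `Ψ` (the value `1` means rejection of `θ = 0`). -/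
def firstKindError (b : ℕ+ → ℝ) (ε : ℝ) (Ψ : (ℕ+ → ℝ) → Fin 2) : ℝ≥0∞ :=
  law b ε 0 {y | Ψ y = 1}

/-- Maximal second kind error probability of the test `Ψ` over a set `F` of signals. -/
def secondKindError (b : ℕ+ → ℝ) (ε : ℝ) (F : Set ℓ²(ℕ+, ℝ)) (Ψ : (ℕ+ → ℝ) → Fin 2) : ℝ≥0∞ :=
  ⨆ θ ∈ F, law b ε θ {y | Ψ y = 0}

/-- `Ψ` is an `α`-level (non-randomized) test: measurable, with first kind error at most `α`. -/
def IsLevelTest (b : ℕ+ → ℝ) (ε α : ℝ) (Ψ : (ℕ+ → ℝ) → Fin 2) : Prop :=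
  Measurable Ψ ∧ firstKindError b ε Ψ ≤ ENNReal.ofReal α

/-- Separation radius of the test `Ψ`: the infimum, in `[0, ∞]`, of the radii `r > 0` for which the
maximal second kind error probability over `Θ_a(r)` is at most `β`. -/
def separationRadius (a b : ℕ+ → ℝ) (ε β : ℝ) (Ψ : (ℕ+ → ℝ) → Fin 2) : ℝ≥0∞ :=
  ⨅ (r : ℝ) (_ : 0 < r)
    (_ : secondKindError b ε (alternative a r) Ψ ≤ ENNReal.ofReal β), ENNReal.ofReal r

/-- Minimax separation radius: the infimum of the separation radii of all `α`-level tests. -/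
def minimaxRadius (a b : ℕ+ → ℝ) (ε α β : ℝ) : ℝ≥0∞ :=
  ⨅ (Ψ : (ℕ+ → ℝ) → Fin 2) (_ : IsLevelTest b ε α Ψ), separationRadius a b ε β Ψ

/-- The constant `c(α, β) = (2 ln(1 + 4 (1 - α - β)²))^{1/4}` of the lower bound. -/
def lowerConst (α β : ℝ) : ℝ :=
  (2 * Real.log (1 + 4 * (1 - α - β) ^ 2)) ^ (1 / 4 : ℝ)

/-- The constant `C(α, β) = √(2 x_β) + √(2 (x_α + x_β)) + √2 (√x_α + √x_β)^{1/2}` of the upper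
bound, where `x_γ = ln(1 / γ)`. -/
def upperConst (α β : ℝ) : ℝ :=
  √(2 * Real.log (1 / β)) + √(2 * (Real.log (1 / α) + Real.log (1 / β)))
    + √2 * √(√(Real.log (1 / α)) + √(Real.log (1 / β)))

end

end GaussianSequence

/-! Upper bound: estimate the energy of the first `D` coefficients by `∑ ((Y_j / b_j)² - σ_j²)`,
with `σ_j = ε / b_j`, and reject when it is large. With `S² = ∑ σ_j⁴`, chi-square deviations fix the
level-`α` threshold `2S(√x_α + x_α)`. Under `θ`, the statistic falls below the truncated energy `E`
by more than `2√(S² + 2SE)√x_β` with probability at most `β`. `noncentral_threshold_le` shows that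
`E ≥ C²S` is enough, and `norm_sq_le_sum_add` bounds the energy lost beyond `D` by `a_D⁻²`.

Lower bound: put independent uniform signs on `D` coefficients of fixed moduli and total norm `r`.
After whitening to shifts `±m_j`, the likelihood ratio of the mixture has second moment `∏
cosh(m_j²) ≤ exp(∑ m_j⁴ / 2)`. Le Cam's bound turns errors `α` and `β` into `1 + 4(1 - α - β)² ≤
exp(∑ m_j⁴ / 2)` (`one_add_sq_le_exp_of_forall_sign`), which fails for small `r`. -/

/-! ### Product measures and Gaussian Laplace transforms. -/

lemma lintegral_finset_prod_infinitePi {ι : Type*} {X : ι → Type*} [∀ i, MeasurableSpace (X i)]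
    (μ : ∀ i, Measure (X i)) [∀ i, IsProbabilityMeasure (μ i)] (s : Finset ι)
    {f : ∀ i, X i → ℝ≥0∞} (hf : ∀ i, Measurable (f i)) :
    ∫⁻ x, ∏ i ∈ s, f i (x i) ∂Measure.infinitePi μ = ∏ i ∈ s, ∫⁻ x, f i x ∂μ i := by
  rw [lintegral_prod_eq_prod_lintegral_of_indepFun s (fun i (x : ∀ i, X i) => f i (x i))
    (iIndepFun_infinitePi (P := μ) (X := f) hf) (fun i => (hf i).comp (measurable_pi_apply i))]
  refine Finset.prod_congr rfl fun i _ => ?_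
  rw [← lintegral_map (hf i) (measurable_pi_apply i), Measure.infinitePi_map_eval]

lemma infinitePi_withDensity {ι : Type*} {X : ι → Type*} [∀ i, MeasurableSpace (X i)]
    (μ ν : ∀ i, Measure (X i)) [∀ i, IsProbabilityMeasure (μ i)] [∀ i, IsProbabilityMeasure (ν i)]
    (s : Finset ι) {f : ∀ i, X i → ℝ≥0∞} (hf : ∀ i, Measurable (f i))
    (hs : ∀ i ∈ s, ν i = (μ i).withDensity (f i)) (hns : ∀ i ∉ s, ν i = μ i) :
    Measure.infinitePi ν = (Measure.infinitePi μ).withDensity (fun x => ∏ i ∈ s, f i (x i)) := by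
  classical
  refine (Measure.eq_infinitePi ν fun u t ht => ?_).symm
  have hmeas : MeasurableSet (Set.pi (u : Set ι) t) :=
    .pi u.countable_toSet fun i _ => ht i
  rw [withDensity_apply _ hmeas, ← lintegral_indicator hmeas]
  -- Density factors and box indicators merge into one product over `s ∪ u`, to which independence
  -- applies.
  let g : ∀ i, X i → ℝ≥0∞ := fun i x =>
    (if i ∈ s then f i x else 1) * (if i ∈ u then (t i).indicator 1 x else 1)
  have hg : ∀ i, Measurable (g i) := by
    intro i
    have := hf i
    have h1 : Measurable ((t i).indicator (1 : X i → ℝ≥0∞)) := measurable_one.indicator (ht i)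
    by_cases h : i ∈ s <;> by_cases h' : i ∈ u <;> simp only [g, h, h', if_true, if_false] <;>
      fun_prop
  have key : ∀ x : ∀ i, X i, (Set.pi (u : Set ι) t).indicator (fun x => ∏ i ∈ s, f i (x i)) x
      = ∏ i ∈ s ∪ u, g i (x i) := by
    intro x
    simp only [g]
    rw [Finset.prod_mul_distrib, Finset.prod_ite_mem, Finset.prod_ite_mem,
      Finset.union_inter_cancel_left, Finset.union_inter_cancel_right]
    by_cases hx : x ∈ Set.pi (u : Set ι) t
    · rw [Set.indicator_of_mem hx, Finset.prod_eq_one (s := u), mul_one]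
      intro i hi
      rw [Set.indicator_of_mem (hx i hi)]; rfl
    · rw [Set.indicator_of_notMem hx]
      obtain ⟨i, hi, hxi⟩ : ∃ i ∈ u, x i ∉ t i := by
        simpa [Set.mem_pi] using hx
      rw [Finset.prod_eq_zero hi (Set.indicator_of_notMem hxi _), mul_zero]
  rw [lintegral_congr key, lintegral_finset_prod_infinitePi μ _ hg]
  have hone : ∀ i, ∫⁻ x, g i x ∂μ i = if i ∈ u then ν i (t i) else 1 := by
    intro i
    have hν : ∀ i, ν i = (μ i).withDensity (fun x => if i ∈ s then f i x else 1) := by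
      intro i
      by_cases h : i ∈ s
      · simp only [h, if_true]; exact hs i h
      · simp only [h, if_false]; rw [hns i h]; exact (withDensity_one (μ := μ i)).symm
    by_cases h' : i ∈ u
    · simp only [g, h', if_true]
      rw [hν i, withDensity_apply _ (ht i), ← lintegral_indicator (ht i)]
      refine lintegral_congr fun x => ?_
      by_cases hx : x ∈ t i <;> simp [hx]
    · simp only [g, h', if_false, mul_one]
      have := measure_univ (μ := ν i)
      rwa [hν i, withDensity_apply _ .univ, setLIntegral_univ] at this
  rw [Finset.prod_congr rfl fun i _ => hone i, Finset.prod_ite_mem,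
    Finset.union_inter_cancel_right]

/-- Completing the square makes the tilted density a multiple of that of `N(v / (1 - 2u), 1 / (1 -
2u))`. -/
lemma lintegral_exp_quadratic_gaussianReal {u : ℝ} (hu : u < 1 / 2) (v : ℝ) :
    ∫⁻ x, ENNReal.ofReal (Real.exp (u * x ^ 2 + v * x)) ∂gaussianReal 0 1
      = ENNReal.ofReal ((√(1 - 2 * u))⁻¹ * Real.exp (v ^ 2 / (2 * (1 - 2 * u)))) := by
  have hp : 0 < 1 - 2 * u := by linarith
  let w : NNReal := ⟨(1 - 2 * u)⁻¹, (inv_pos.2 hp).le⟩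
  have hw : (w : ℝ) = (1 - 2 * u)⁻¹ := rfl
  have hw0 : w ≠ 0 := by
    intro h; have : (w : ℝ) = 0 := by rw [h]; rfl
    rw [hw] at this; exact (inv_pos.2 hp).ne' this
  have hpt : ∀ x : ℝ, gaussianPDF 0 1 x * ENNReal.ofReal (Real.exp (u * x ^ 2 + v * x))
      = ENNReal.ofReal ((√(1 - 2 * u))⁻¹ * Real.exp (v ^ 2 / (2 * (1 - 2 * u))))
        * gaussianPDF (v / (1 - 2 * u)) w x := by
    intro x
    simp only [gaussianPDF]
    rw [← ENNReal.ofReal_mul (gaussianPDFReal_nonneg _ _ _), ← ENNReal.ofReal_mul (by positivity)]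
    congr 1
    simp only [gaussianPDFReal, hw]
    have h1 : √(2 * Real.pi * (1 - 2 * u)⁻¹) = √(2 * Real.pi) * (√(1 - 2 * u))⁻¹ := by
      rw [Real.sqrt_mul (by positivity), Real.sqrt_inv]
    have h2 : √(1 - 2 * u) ≠ 0 := (Real.sqrt_pos.2 hp).ne'
    rw [h1, mul_inv, inv_inv, NNReal.coe_one, mul_one, mul_assoc, ← Real.exp_add]
    have e : -(x - 0) ^ 2 / (2 * 1) + (u * x ^ 2 + v * x)
        = v ^ 2 / (2 * (1 - 2 * u)) + -(x - v / (1 - 2 * u)) ^ 2 / (2 * (1 - 2 * u)⁻¹) := by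
      field_simp
      ring
    rw [e, Real.exp_add]
    field_simp
  rw [gaussianReal_of_var_ne_zero _ one_ne_zero,
    lintegral_withDensity_eq_lintegral_mul _ (measurable_gaussianPDF _ _) (by fun_prop)]
  simp only [Pi.mul_apply]
  rw [lintegral_congr hpt, lintegral_const_mul _ (measurable_gaussianPDF _ _),
    lintegral_gaussianPDF_eq_one _ hw0, mul_one]

/-- Chernoff's method; the tilting parameter is already absorbed into `f`. -/
lemma measure_sum_ge_le_of_lintegral_exp_le {ι : Type*} {X : ι → Type*}
    [∀ i, MeasurableSpace (X i)]
    (μ : ∀ i, Measure (X i)) [∀ i, IsProbabilityMeasure (μ i)] (s : Finset ι)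
    {f : ∀ i, X i → ℝ} (hf : ∀ i, Measurable (f i)) {K : ι → ℝ}
    (hK : ∀ i ∈ s, ∫⁻ x, ENNReal.ofReal (Real.exp (f i x)) ∂μ i ≤ ENNReal.ofReal (Real.exp (K i)))
    (t : ℝ) :
    Measure.infinitePi μ {x | t ≤ ∑ i ∈ s, f i (x i)}
      ≤ ENNReal.ofReal (Real.exp (∑ i ∈ s, K i - t)) := by
  have hprod : ∀ x : ∀ i, X i, ENNReal.ofReal (Real.exp (∑ i ∈ s, f i (x i)))
      = ∏ i ∈ s, ENNReal.ofReal (Real.exp (f i (x i))) := fun x => by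
    rw [Real.exp_sum, ENNReal.ofReal_prod_of_nonneg fun i _ => (Real.exp_pos _).le]
  have h1 := mul_meas_ge_le_lintegral₀ (μ := Measure.infinitePi μ)
    (f := fun x => ENNReal.ofReal (Real.exp (∑ i ∈ s, f i (x i))))
    (Measurable.aemeasurable (by fun_prop)) (ENNReal.ofReal (Real.exp t))
  have hset : {x : ∀ i, X i | t ≤ ∑ i ∈ s, f i (x i)} =
      {x | ENNReal.ofReal (Real.exp t) ≤ ENNReal.ofReal (Real.exp (∑ i ∈ s, f i (x i)))} := by
    ext x
    simp [ENNReal.ofReal_le_ofReal_iff (Real.exp_pos _).le]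
  rw [← hset, lintegral_congr hprod, lintegral_finset_prod_infinitePi μ s
    (f := fun i x => ENNReal.ofReal (Real.exp (f i x))) (fun i => by have := hf i; fun_prop)] at h1
  have h2 : ∏ i ∈ s, ∫⁻ x, ENNReal.ofReal (Real.exp (f i x)) ∂μ i
      ≤ ENNReal.ofReal (Real.exp (∑ i ∈ s, K i)) := by
    rw [Real.exp_sum, ENNReal.ofReal_prod_of_nonneg fun i _ => (Real.exp_pos _).le]
    exact Finset.prod_le_prod' hK
  rw [Real.exp_sub, ENNReal.ofReal_div_of_pos (Real.exp_pos _)]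
  rw [ENNReal.le_div_iff_mul_le (Or.inl (by simp [Real.exp_pos])) (Or.inl ENNReal.ofReal_ne_top),
    mul_comm]
  exact h1.trans h2

lemma lintegral_exp_sq_sub_one_gaussianReal_le {u : ℝ} (hu0 : 0 ≤ u) (hu : u < 1 / 2) :
    ∫⁻ x, ENNReal.ofReal (Real.exp (u * (x ^ 2 - 1))) ∂gaussianReal 0 1
      ≤ ENNReal.ofReal (Real.exp (u ^ 2 / (1 - 2 * u))) := by
  have hp : 0 < 1 - 2 * u := by linarith
  have h : ∀ x : ℝ, ENNReal.ofReal (Real.exp (u * (x ^ 2 - 1)))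
      = ENNReal.ofReal (Real.exp (-u)) * ENNReal.ofReal (Real.exp (u * x ^ 2 + 0 * x)) := by
    intro x
    rw [← ENNReal.ofReal_mul (Real.exp_pos _).le, ← Real.exp_add]
    ring_nf
  rw [lintegral_congr h, lintegral_const_mul _ (by fun_prop),
    lintegral_exp_quadratic_gaussianReal hu, ← ENNReal.ofReal_mul (Real.exp_pos _).le]
  refine ENNReal.ofReal_le_ofReal ?_
  have hs : (√(1 - 2 * u))⁻¹ = Real.exp (Real.log ((1 - 2 * u)⁻¹) / 2) := by
    rw [Real.log_inv, ← Real.sqrt_inv, Real.exp_half, Real.exp_neg, Real.exp_log hp]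
  -- `log y ≤ sinh (log y) = (y - 1/y) / 2` at `y = 1 / (1 - 2u)` gives exactly the required
  -- exponent.
  have hl := Real.self_le_sinh_iff.2 (Real.log_nonneg ((one_le_inv₀ hp).2 (by linarith)))
  rw [Real.sinh_log (by positivity), inv_inv] at hl
  rw [hs]
  simp only [ne_eq, OfNat.ofNat_ne_zero, not_false_eq_true, zero_pow, zero_div, Real.exp_zero,
    mul_one]
  rw [← Real.exp_add, Real.exp_le_exp]
  have : u ^ 2 / (1 - 2 * u) = ((1 - 2 * u)⁻¹ - (1 - 2 * u)) / 4 - u := by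
    obtain ⟨w, hw⟩ : ∃ w, w = 1 - 2 * u := ⟨_, rfl⟩
    obtain rfl : u = (1 - w) / 2 := by linarith
    rw [← hw] at hp ⊢
    field_simp; ring
  rw [this]
  linarith

lemma lintegral_exp_neg_noncentral_gaussianReal_le {l : ℝ} (hl : 0 ≤ l) (τ σ : ℝ) :
    ∫⁻ x, ENNReal.ofReal (Real.exp (-l * ((τ + σ * x) ^ 2 - τ ^ 2 - σ ^ 2))) ∂gaussianReal 0 1
      ≤ ENNReal.ofReal (Real.exp (l ^ 2 * (σ ^ 4 + 2 * σ ^ 2 * τ ^ 2))) := by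
  have hy : 0 ≤ 2 * l * σ ^ 2 := by positivity
  have h : ∀ x : ℝ, ENNReal.ofReal (Real.exp (-l * ((τ + σ * x) ^ 2 - τ ^ 2 - σ ^ 2)))
      = ENNReal.ofReal (Real.exp (l * σ ^ 2))
        * ENNReal.ofReal (Real.exp (-(l * σ ^ 2) * x ^ 2 + (-2 * l * τ * σ) * x)) := by
    intro x
    rw [← ENNReal.ofReal_mul (Real.exp_pos _).le, ← Real.exp_add]
    ring_nf
  rw [lintegral_congr h, lintegral_const_mul _ (by fun_prop),
    lintegral_exp_quadratic_gaussianReal (by nlinarith), ← ENNReal.ofReal_mul (Real.exp_pos _).le]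
  refine ENNReal.ofReal_le_ofReal ?_
  have e1 : 1 - 2 * -(l * σ ^ 2) = 1 + 2 * l * σ ^ 2 := by ring
  have hp : 0 < 1 + 2 * l * σ ^ 2 := by linarith
  rw [e1]
  have hs : (√(1 + 2 * l * σ ^ 2))⁻¹ = Real.exp (-Real.log (1 + 2 * l * σ ^ 2) / 2) := by
    rw [Real.exp_half, Real.exp_neg, Real.exp_log hp, Real.sqrt_inv]
  rw [hs, ← Real.exp_add, ← Real.exp_add, Real.exp_le_exp]
  -- With `y = 2lσ²`, `log (1 + y) ≥ 2y / (y + 2) ≥ y - y²/2`. No upper limit on `l` is needed, so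
  -- the lower tail is purely sub-Gaussian.
  have hlog := Real.le_log_one_add_of_nonneg hy
  have hlow : 2 * l * σ ^ 2 - (2 * l * σ ^ 2) ^ 2 / 2
      ≤ 2 * (2 * l * σ ^ 2) / (2 * l * σ ^ 2 + 2) := by
    rw [le_div_iff₀ (by positivity)]
    nlinarith [pow_nonneg hy 3]
  have hq : (-2 * l * τ * σ) ^ 2 / (2 * (1 + 2 * l * σ ^ 2)) ≤ 2 * l ^ 2 * σ ^ 2 * τ ^ 2 := by
    rw [div_le_iff₀ (by positivity)]
    have : 0 ≤ l ^ 2 * σ ^ 2 * τ ^ 2 * (2 * l * σ ^ 2) := by positivity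
    nlinarith
  nlinarith

/-! ### Chi-square deviation inequalities. -/

/-- Laurent–Massart upper tail bound for weighted centred chi-square sums, with the supremum of
the weights bounded by their Euclidean norm. -/
lemma measure_chiSq_upper_tail_le {ι : Type*} (s : Finset ι) (σ : ι → ℝ) {S : ℝ} (hS : 0 < S)
    (hσ : ∑ i ∈ s, σ i ^ 4 ≤ S ^ 2) {x : ℝ} (hx : 0 ≤ x) :
    Measure.infinitePi (fun _ : ι => gaussianReal 0 1)
        {ξ | 2 * S * (√x + x) ≤ ∑ i ∈ s, ((σ i * ξ i) ^ 2 - σ i ^ 2)}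
      ≤ ENNReal.ofReal (Real.exp (-x)) := by
  set q := √x with hq
  have hq0 : 0 ≤ q := Real.sqrt_nonneg x
  have hxq : x = q ^ 2 := (Real.sq_sqrt hx).symm
  -- The minimiser of `v² / (1 - 2v) - 2v(q + q²)`, with minimum `-q² = -x`; the Chernoff parameter
  -- is `v / S`.
  set v := q / (1 + 2 * q) with hv
  have hv0 : 0 ≤ v := by positivity
  have hv1 : 1 - 2 * v = (1 + 2 * q)⁻¹ := by rw [hv]; field_simp; ring
  have hv2 : 0 < 1 - 2 * v := by rw [hv1]; positivity
  have hle : ∀ i ∈ s, σ i ^ 2 ≤ S := fun i hi => by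
    have h4 : σ i ^ 4 ≤ S ^ 2 :=
      (Finset.single_le_sum (f := fun i => σ i ^ 4) (fun i _ => by positivity) hi).trans hσ
    exact le_of_sq_le_sq (by nlinarith) hS.le
  have hu : ∀ i ∈ s, v / S * σ i ^ 2 ≤ v := fun i hi => by
    rw [div_mul_eq_mul_div, div_le_iff₀ hS]
    exact mul_le_mul_of_nonneg_left (hle i hi) hv0
  have hK : ∀ i ∈ s, ∫⁻ y, ENNReal.ofReal (Real.exp (v / S * σ i ^ 2 * (y ^ 2 - 1)))
      ∂gaussianReal 0 1 ≤ ENNReal.ofReal (Real.exp ((v / S) ^ 2 * σ i ^ 4 / (1 - 2 * v))) := by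
    intro i hi
    refine (lintegral_exp_sq_sub_one_gaussianReal_le (by positivity)
      ((hu i hi).trans_lt (by linarith))).trans (ENNReal.ofReal_le_ofReal (Real.exp_le_exp.2 ?_))
    have := hu i hi
    rw [show (v / S) ^ 2 * σ i ^ 4 = (v / S * σ i ^ 2) ^ 2 by ring]
    gcongr
  have main := measure_sum_ge_le_of_lintegral_exp_le (fun _ : ι => gaussianReal 0 1) s
    (f := fun i y => v / S * σ i ^ 2 * (y ^ 2 - 1)) (fun i => by fun_prop) hK
    (v / S * (2 * S * (q + x)))
  refine (measure_mono fun ξ hξ => ?_).trans (main.trans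
    (ENNReal.ofReal_le_ofReal (Real.exp_le_exp.2 ?_)))
  · simp only [Set.mem_ofPred_eq] at hξ ⊢
    calc v / S * (2 * S * (q + x)) ≤ v / S * ∑ i ∈ s, ((σ i * ξ i) ^ 2 - σ i ^ 2) := by gcongr
      _ = _ := by rw [Finset.mul_sum]; exact Finset.sum_congr rfl fun i _ => by ring
  · rw [← Finset.sum_div, ← Finset.mul_sum]
    have h1 : (v / S) ^ 2 * ∑ i ∈ s, σ i ^ 4 ≤ v ^ 2 := by
      calc (v / S) ^ 2 * ∑ i ∈ s, σ i ^ 4 ≤ (v / S) ^ 2 * S ^ 2 := by gcongr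
        _ = v ^ 2 := by field_simp
    have h3 : v ^ 2 / (1 - 2 * v) - v / S * (2 * S * (q + x)) = -x := by
      rw [hv1, hxq, hv]; field_simp; ring
    have h4 : (v / S) ^ 2 * (∑ i ∈ s, σ i ^ 4) / (1 - 2 * v) ≤ v ^ 2 / (1 - 2 * v) := by gcongr
    linarith

/-- Lower tail bound for weighted noncentral chi-square sums. -/
lemma measure_noncentral_chiSq_lower_tail_le {ι : Type*} (s : Finset ι) (τ σ : ι → ℝ) {V : ℝ}
    (hV : 0 < V) (hσ : ∑ i ∈ s, (σ i ^ 4 + 2 * σ i ^ 2 * τ i ^ 2) ≤ V) {x : ℝ} (hx : 0 ≤ x) :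
    Measure.infinitePi (fun _ : ι => gaussianReal 0 1)
        {ξ | ∑ i ∈ s, ((τ i + σ i * ξ i) ^ 2 - τ i ^ 2 - σ i ^ 2) ≤ -(2 * √V * √x)}
      ≤ ENNReal.ofReal (Real.exp (-x)) := by
  have hV' : 0 < √V := Real.sqrt_pos.2 hV
  -- The minimiser of `l²V - 2l√V√x`, with minimum `-x`.
  set l := √x / √V with hl
  have hl0 : 0 ≤ l := by positivity
  have main := measure_sum_ge_le_of_lintegral_exp_le (fun _ : ι => gaussianReal 0 1) s
    (f := fun i y => -l * ((τ i + σ i * y) ^ 2 - τ i ^ 2 - σ i ^ 2)) (fun i => by fun_prop)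
    (fun i _ => lintegral_exp_neg_noncentral_gaussianReal_le hl0 (τ i) (σ i)) (2 * x)
  refine (measure_mono fun ξ hξ => ?_).trans (main.trans
    (ENNReal.ofReal_le_ofReal (Real.exp_le_exp.2 ?_)))
  · simp only [Set.mem_ofPred_eq] at hξ ⊢
    rw [← Finset.mul_sum]
    have h1 := mul_le_mul_of_nonneg_left hξ hl0
    have h2 : l * -(2 * √V * √x) = -(2 * x) := by
      have : √x * √x = x := Real.mul_self_sqrt hx
      rw [hl]; field_simp; linarith
    linarith
  · rw [← Finset.mul_sum]
    have h1 : l ^ 2 * ∑ i ∈ s, (σ i ^ 4 + 2 * σ i ^ 2 * τ i ^ 2) ≤ l ^ 2 * V := by gcongr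
    have h2 : l ^ 2 * V = x := by
      rw [hl, div_pow, Real.sq_sqrt hx, Real.sq_sqrt hV.le]; field_simp
    linarith

/-! ### The upper bound. -/

namespace GaussianSequence

lemma measurable_law_map (b : ℕ+ → ℝ) (ε : ℝ) (θ : ℓ²(ℕ+, ℝ)) :
    Measurable (fun (ξ : ℕ+ → ℝ) (j : ℕ+) => b j * θ j + ε * ξ j) := by
  fun_prop

lemma law_apply (b : ℕ+ → ℝ) (ε : ℝ) (θ : ℓ²(ℕ+, ℝ)) {A : Set (ℕ+ → ℝ)} (hA : MeasurableSet A) :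
    law b ε θ A = Measure.infinitePi (fun _ : ℕ+ => gaussianReal 0 1)
      {ξ | (fun j => b j * θ j + ε * ξ j) ∈ A} := by
  rw [law, Measure.map_apply (measurable_law_map b ε θ) hA]
  rfl

lemma hasSum_sq_norm_sq (θ : ℓ²(ℕ+, ℝ)) : HasSum (fun j => θ j ^ 2) (‖θ‖ ^ 2) := by
  have := lp.hasSum_norm (p := 2) (by norm_num) θ
  simpa using this

lemma norm_sq_le_sum_add (a : ℕ+ → ℝ) (ha : ∀ j, 0 < a j) (ha_mono : Monotone a)
    {θ : ℓ²(ℕ+, ℝ)} (hθ : θ ∈ ellipsoid a 1) (D : ℕ+) :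
    ‖θ‖ ^ 2 ≤ ∑ j ∈ Finset.Icc 1 D, θ j ^ 2 + ((a D) ^ 2)⁻¹ := by
  obtain ⟨hs, h1⟩ := hθ
  have hfin : HasSum (fun j => if j ∈ Finset.Icc 1 D then θ j ^ 2 else 0)
      (∑ j ∈ Finset.Icc 1 D, θ j ^ 2) := by
    have := hasSum_sum_of_ne_finset_zero
      (f := fun j => if j ∈ Finset.Icc 1 D then θ j ^ 2 else 0) (s := Finset.Icc 1 D)
      (L := SummationFilter.unconditional _) (fun j hj => by simp only [hj, if_false])
    rwa [Finset.sum_congr rfl (g := fun j => θ j ^ 2)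
      (fun j hj => by simp only [hj, if_true])] at this
  have hsum := hfin.add (hs.hasSum.mul_left ((a D) ^ 2)⁻¹)
  have haD := ha D
  refine (hasSum_le (fun j => ?_) (hasSum_sq_norm_sq θ) hsum).trans ?_
  · by_cases hj : j ∈ Finset.Icc 1 D
    · simp only [hj, if_true]
      have : 0 ≤ ((a D) ^ 2)⁻¹ * (a j ^ 2 * θ j ^ 2) := by positivity
      linarith
    · simp only [hj, if_false, zero_add]
      have hDj : D ≤ j := by
        by_contra h
        exact hj (Finset.mem_Icc.2 ⟨one_le, (not_le.1 h).le⟩)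
      have hle : a D ^ 2 ≤ a j ^ 2 := pow_le_pow_left₀ haD.le (ha_mono hDj) 2
      rw [← mul_assoc, inv_mul_eq_div]
      exact le_mul_of_one_le_left (sq_nonneg _) ((one_le_div (by positivity)).2 hle)
  · have : ((a D) ^ 2)⁻¹ * ∑' j, a j ^ 2 * θ j ^ 2 ≤ ((a D) ^ 2)⁻¹ * 1 := by gcongr
    linarith

/-- This explains `C`: since `√(s² + 2sE) ≤ s + √(2sE)`, a quadratic inequality in `√E` suffices.
Completing the square reduces it to `(√E - √(2s xβ))² ≥ 2s(xα + xβ + √xα + √xβ)`, and the last two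
terms of `C` cover the right side. -/
lemma noncentral_threshold_le {s E xα xβ : ℝ} (hs : 0 ≤ s) (hα : 0 ≤ xα) (hβ : 0 ≤ xβ)
    (hE : (√(2 * xβ) + √(2 * (xα + xβ)) + √2 * √(√xα + √xβ)) ^ 2 * s ≤ E) :
    2 * s * (√xα + xα) + 2 * √(s ^ 2 + 2 * s * E) * √xβ ≤ E := by
  have hE0 : 0 ≤ E := le_trans (by positivity) hE
  have hB2 : √(2 * xβ) = √2 * √xβ := Real.sqrt_mul (by norm_num) _
  have hP2 : √(2 * (xα + xβ)) ^ 2 = 2 * (xα + xβ) := Real.sq_sqrt (by positivity)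
  have hQ2 : √(√xα + √xβ) ^ 2 = √xα + √xβ := Real.sq_sqrt (by positivity)
  have hα2 : √xα ^ 2 = xα := Real.sq_sqrt hα
  have hβ2 : √xβ ^ 2 = xβ := Real.sq_sqrt hβ
  have hk2 : √s ^ 2 = s := Real.sq_sqrt hs
  have hn2 : √E ^ 2 = E := Real.sq_sqrt hE0
  have hw2 : √2 ^ 2 = (2 : ℝ) := Real.sq_sqrt (by norm_num)
  have hV : √(s ^ 2 + 2 * s * E) ≤ s + √2 * √s * √E := by
    rw [Real.sqrt_le_left (by positivity)]
    have h1 : (√2 * √s * √E) ^ 2 = 2 * s * E := by rw [mul_pow, mul_pow, hk2, hn2, hw2]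
    have h2 : 0 ≤ s * (√2 * √s * √E) := by positivity
    nlinarith
  have hn : (√2 * √xβ + √(2 * (xα + xβ)) + √2 * √(√xα + √xβ)) * √s ≤ √E := by
    apply Real.le_sqrt_of_sq_le
    rw [mul_pow, hk2, ← hB2]; exact hE
  set A := √xα
  set B := √xβ
  set P := √(2 * (xα + xβ))
  set Q := √(A + B)
  set k := √s
  set n := √E
  set w := √2
  have hd : (P + w * Q) * k ≤ n - w * k * B := by linarith
  have hd2 : ((P + w * Q) * k) ^ 2 ≤ (n - w * k * B) ^ 2 :=
    pow_le_pow_left₀ (by positivity) hd 2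
  have hPQ : 2 * (xα + xβ) + 2 * (A + B) ≤ (P + w * Q) ^ 2 := by
    have h0 : 0 ≤ P * (w * Q) := by positivity
    have h1 : (w * Q) ^ 2 = 2 * (A + B) := by rw [mul_pow, hw2, hQ2]
    nlinarith
  have h3 : (2 * (xα + xβ) + 2 * (A + B)) * s ≤ (n - w * k * B) ^ 2 := by
    rw [mul_pow, hk2] at hd2
    exact (mul_le_mul_of_nonneg_right hPQ hs).trans hd2
  have h4 : (n - w * k * B) ^ 2 = E - 2 * (w * k * n) * B + 2 * s * xβ := by
    have : (w * k * B) ^ 2 = 2 * s * xβ := by rw [mul_pow, mul_pow, hw2, hk2, hβ2]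
    nlinarith
  have h5 : 2 * √(s ^ 2 + 2 * s * E) * B ≤ 2 * (s + w * k * n) * B := by gcongr
  nlinarith

lemma minimaxRadius_sq_le (a b : ℕ+ → ℝ) (ha : ∀ j, 0 < a j) (ha_mono : Monotone a)
    (hb : ∀ j, 0 < b j) {α β : ℝ} (hα : α ∈ Set.Ioo (0 : ℝ) 1) (hβ : β ∈ Set.Ioo (0 : ℝ) 1)
    {ε : ℝ} (hε : 0 < ε) (D : ℕ+) :
    minimaxRadius a b ε α β ^ 2 ≤ ENNReal.ofReal (upperConst α β ^ 2 * ε ^ 2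
      * √(∑ j ∈ Finset.Icc 1 D, ((b j) ^ 4)⁻¹) + ((a D) ^ 2)⁻¹) := by
  set I := Finset.Icc 1 D with hI
  have hxα : 0 ≤ Real.log (1 / α) := Real.log_nonneg ((one_le_div hα.1).2 hα.2.le)
  have hxβ : 0 ≤ Real.log (1 / β) := Real.log_nonneg ((one_le_div hβ.1).2 hβ.2.le)
  have heα : Real.exp (-Real.log (1 / α)) = α := by
    rw [one_div, Real.log_inv, neg_neg, Real.exp_log hα.1]
  have heβ : Real.exp (-Real.log (1 / β)) = β := by
    rw [one_div, Real.log_inv, neg_neg, Real.exp_log hβ.1]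
  set B := ∑ j ∈ I, ((b j) ^ 4)⁻¹ with hB
  have hBpos : 0 < B := Finset.sum_pos (fun j _ => by have := hb j; positivity)
    ⟨1, Finset.mem_Icc.2 ⟨le_rfl, one_le⟩⟩
  set σ : ℕ+ → ℝ := fun j => ε / b j with hσ
  set S := ε ^ 2 * √B with hS
  have hSpos : 0 < S := by positivity
  have hσS : ∑ j ∈ I, σ j ^ 4 = S ^ 2 := by
    rw [hS, mul_pow, Real.sq_sqrt hBpos.le, hB, Finset.mul_sum]
    refine Finset.sum_congr rfl fun j _ => ?_
    rw [hσ]; ring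
  have hσle : ∀ i ∈ I, σ i ^ 2 ≤ S := fun i hi => by
    have h4 : σ i ^ 4 ≤ S ^ 2 := hσS ▸
      Finset.single_le_sum (f := fun i => σ i ^ 4) (fun i _ => by positivity) hi
    exact le_of_sq_le_sq (by nlinarith) hSpos.le
  let T : (ℕ+ → ℝ) → ℝ := fun y => ∑ j ∈ I, ((y j / b j) ^ 2 - σ j ^ 2)
  have hT : Measurable T := by fun_prop
  set t := 2 * S * (√(Real.log (1 / α)) + Real.log (1 / α)) with ht
  let Ψ : (ℕ+ → ℝ) → Fin 2 := fun y => if t ≤ T y then 1 else 0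
  have hTt : MeasurableSet {y | t ≤ T y} := measurableSet_le measurable_const hT
  have hΨ : Measurable Ψ := Measurable.ite hTt measurable_const measurable_const
  have hΨ1 : {y | Ψ y = 1} = {y | t ≤ T y} := by
    ext y; simp [Ψ]
  have hΨ0 : {y | Ψ y = 0} = {y | T y < t} := by
    ext y; simp [Ψ]
  have hTlaw : ∀ (θ : ℓ²(ℕ+, ℝ)) (ξ : ℕ+ → ℝ), T (fun j => b j * θ j + ε * ξ j)
      = ∑ j ∈ I, ((θ j + σ j * ξ j) ^ 2 - σ j ^ 2) := by
    intro θ ξ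
    refine Finset.sum_congr rfl fun j _ => ?_
    have := (hb j).ne'
    congr 2
    rw [hσ]; field_simp
  have hlevel : IsLevelTest b ε α Ψ := by
    refine ⟨hΨ, ?_⟩
    rw [firstKindError, hΨ1, law_apply b ε 0 hTt]
    have := measure_chiSq_upper_tail_le I σ hSpos hσS.le hxα
    rw [heα] at this
    refine (measure_mono fun ξ hξ => ?_).trans this
    have h : t ≤ T (fun j => b j * (0 : ℓ²(ℕ+, ℝ)) j + ε * ξ j) := hξ
    rw [hTlaw] at h
    exact h.trans_eq (Finset.sum_congr rfl fun j _ => by simp)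
  -- The term `a_D⁻²` pays for truncation, leaving energy at least `C²S` in the first `D`
  -- coordinates.
  set R := upperConst α β ^ 2 * ε ^ 2 * √B + ((a D) ^ 2)⁻¹ with hR
  have hRpos : 0 < R := by have := ha D; positivity
  have hpow : secondKindError b ε (alternative a √R) Ψ ≤ ENNReal.ofReal β := by
    refine iSup₂_le fun θ hθ => ?_
    obtain ⟨hell, hnorm⟩ := hθ
    rw [hΨ0, law_apply b ε θ (measurableSet_lt hT measurable_const)]
    set E := ∑ j ∈ I, θ j ^ 2 with hE
    have hE0 : 0 ≤ E := Finset.sum_nonneg fun j _ => sq_nonneg _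
    have hRE : upperConst α β ^ 2 * S ≤ E := by
      have h1 := norm_sq_le_sum_add a ha ha_mono hell D
      have h2 : R ≤ ‖θ‖ ^ 2 := by
        rw [← Real.sq_sqrt hRpos.le]
        exact pow_le_pow_left₀ (Real.sqrt_nonneg _) hnorm 2
      rw [hR, mul_assoc] at h2
      linarith
    have hthr := noncentral_threshold_le hSpos.le hxα hxβ hRE
    have hV : ∑ j ∈ I, (σ j ^ 4 + 2 * σ j ^ 2 * θ j ^ 2) ≤ S ^ 2 + 2 * S * E := by
      rw [Finset.sum_add_distrib, hσS, hE, Finset.mul_sum]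
      gcongr with j hj
      exact hσle j hj
    have := measure_noncentral_chiSq_lower_tail_le I (fun j => θ j) σ
      (by positivity : 0 < S ^ 2 + 2 * S * E) hV hxβ
    rw [heβ] at this
    refine (measure_mono fun ξ hξ => ?_).trans this
    have h : T (fun j => b j * θ j + ε * ξ j) < t := hξ
    rw [hTlaw] at h
    have e : ∑ j ∈ I, ((θ j + σ j * ξ j) ^ 2 - θ j ^ 2 - σ j ^ 2)
        = ∑ j ∈ I, ((θ j + σ j * ξ j) ^ 2 - σ j ^ 2) - E := by
      rw [hE, ← Finset.sum_sub_distrib]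
      exact Finset.sum_congr rfl fun j _ => by ring
    rw [Set.mem_ofPred_eq, e]
    linarith
  have hle : minimaxRadius a b ε α β ≤ ENNReal.ofReal √R :=
    (iInf₂_le Ψ hlevel).trans ((iInf₂_le √R (Real.sqrt_pos.2 hRpos)).trans (iInf_le _ hpow))
  calc minimaxRadius a b ε α β ^ 2 ≤ ENNReal.ofReal √R ^ 2 := by gcongr
    _ = ENNReal.ofReal R := by
      rw [← ENNReal.ofReal_pow (Real.sqrt_nonneg _), Real.sq_sqrt hRpos.le]

end GaussianSequence

/-! ### Likelihood ratios of Gaussian shifts and sign mixtures. -/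

lemma gaussianReal_one_eq_withDensity (h : ℝ) : gaussianReal h 1 =
    (gaussianReal 0 1).withDensity (fun x => ENNReal.ofReal (Real.exp (h * x - h ^ 2 / 2))) := by
  rw [gaussianReal_of_var_ne_zero _ one_ne_zero, gaussianReal_of_var_ne_zero _ one_ne_zero,
    ← withDensity_mul _ (measurable_gaussianPDF _ _) (by fun_prop)]
  congr 1
  funext x
  simp only [gaussianPDF, Pi.mul_apply]
  rw [← ENNReal.ofReal_mul (gaussianPDFReal_nonneg _ _ _)]
  simp only [gaussianPDFReal]
  rw [mul_assoc (√_)⁻¹, ← Real.exp_add]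
  congr 3
  simp only [NNReal.coe_one]
  ring

lemma infinitePi_gaussianReal_map_add {ι : Type*} (s : Finset ι) (h : ι → ℝ)
    (hs : ∀ i ∉ s, h i = 0) :
    (Measure.infinitePi (fun _ : ι => gaussianReal 0 1)).map (fun ξ i => h i + ξ i)
      = (Measure.infinitePi (fun _ : ι => gaussianReal 0 1)).withDensity
        (fun ξ => ∏ i ∈ s, ENNReal.ofReal (Real.exp (h i * ξ i - h i ^ 2 / 2))) := by
  rw [Measure.infinitePi_map_pi (fun _ : ι => gaussianReal 0 1) (f := fun i x => h i + x)
    (fun i => by fun_prop)]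
  have e : ∀ i, (gaussianReal 0 1).map (fun x => h i + x) = gaussianReal (h i) 1 := fun i => by
    rw [gaussianReal_map_const_add, zero_add]
  have : ∀ i, IsProbabilityMeasure ((gaussianReal 0 1).map (fun x => h i + x)) := fun i => by
    rw [e i]; infer_instance
  refine infinitePi_withDensity _ _ s
    (f := fun i x => ENNReal.ofReal (Real.exp (h i * x - h i ^ 2 / 2))) (fun i => by fun_prop)
    (fun i _ => ?_) (fun i hi => ?_)
  · rw [e i, gaussianReal_one_eq_withDensity]
  · rw [e i, hs i hi]

/-- Likelihood ratio between the symmetric two-point mixture of `N(m, 1)` and `N(-m, 1)` and the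
standard Gaussian law. -/
noncomputable def gaussianMixtureRatio (m x : ℝ) : ℝ :=
  Real.exp (-(m ^ 2) / 2) * Real.cosh (m * x)

lemma gaussianMixtureRatio_nonneg (m x : ℝ) : 0 ≤ gaussianMixtureRatio m x :=
  mul_nonneg (Real.exp_pos _).le (Real.cosh_pos _).le

@[fun_prop]
lemma measurable_gaussianMixtureRatio (m : ℝ) : Measurable (gaussianMixtureRatio m) := by
  unfold gaussianMixtureRatio
  fun_prop

lemma ofReal_exp_add_ofReal_exp (m x : ℝ) :
    ENNReal.ofReal (Real.exp (m * x - m ^ 2 / 2))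
      + ENNReal.ofReal (Real.exp (-m * x - (-m) ^ 2 / 2))
      = 2 * ENNReal.ofReal (gaussianMixtureRatio m x) := by
  rw [← ENNReal.ofReal_add (Real.exp_pos _).le (Real.exp_pos _).le,
    ← ENNReal.ofReal_ofNat 2, ← ENNReal.ofReal_mul (by norm_num)]
  congr 1
  rw [gaussianMixtureRatio, Real.cosh_eq, show m * x - m ^ 2 / 2 = -(m ^ 2) / 2 + m * x by ring,
    show -m * x - (-m) ^ 2 / 2 = -(m ^ 2) / 2 + -(m * x) by ring, Real.exp_add, Real.exp_add]
  ring

lemma lintegral_exp_mul_gaussianReal (v : ℝ) :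
    ∫⁻ x, ENNReal.ofReal (Real.exp (v * x)) ∂gaussianReal 0 1
      = ENNReal.ofReal (Real.exp (v ^ 2 / 2)) := by
  simpa using lintegral_exp_quadratic_gaussianReal (u := 0) (by norm_num) v

lemma lintegral_cosh_mul_gaussianReal (v : ℝ) :
    ∫⁻ x, ENNReal.ofReal (Real.cosh (v * x)) ∂gaussianReal 0 1
      = ENNReal.ofReal (Real.exp (v ^ 2 / 2)) := by
  have h : ∀ x : ℝ, ENNReal.ofReal (Real.cosh (v * x)) = ENNReal.ofReal (1 / 2) *
      (ENNReal.ofReal (Real.exp (v * x)) + ENNReal.ofReal (Real.exp (-v * x))) := fun x => by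
    rw [← ENNReal.ofReal_add (Real.exp_pos _).le (Real.exp_pos _).le,
      ← ENNReal.ofReal_mul (by norm_num), Real.cosh_eq, neg_mul]
    ring_nf
  rw [lintegral_congr h, lintegral_const_mul _ (by fun_prop), lintegral_add_left (by fun_prop),
    lintegral_exp_mul_gaussianReal, lintegral_exp_mul_gaussianReal, neg_sq,
    ← ENNReal.ofReal_add (Real.exp_pos _).le (Real.exp_pos _).le,
    ← ENNReal.ofReal_mul (by norm_num)]
  ring_nf

lemma lintegral_gaussianMixtureRatio (m : ℝ) :
    ∫⁻ x, ENNReal.ofReal (gaussianMixtureRatio m x) ∂gaussianReal 0 1 = 1 := by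
  simp only [gaussianMixtureRatio, ENNReal.ofReal_mul (Real.exp_pos _).le]
  rw [lintegral_const_mul _ (by fun_prop), lintegral_cosh_mul_gaussianReal,
    ← ENNReal.ofReal_mul (Real.exp_pos _).le, ← Real.exp_add]
  simp [neg_div]

/-- By `2 cosh² y = cosh 2y + 1`, the integral is `exp(-m²)(exp(2m²) + 1) / 2`. -/
lemma lintegral_gaussianMixtureRatio_sq (m : ℝ) :
    ∫⁻ x, ENNReal.ofReal (gaussianMixtureRatio m x ^ 2) ∂gaussianReal 0 1
      = ENNReal.ofReal (Real.cosh (m ^ 2)) := by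
  have h : ∀ x : ℝ, ENNReal.ofReal (gaussianMixtureRatio m x ^ 2)
      = ENNReal.ofReal (Real.exp (-m ^ 2) / 2) *
        (ENNReal.ofReal (Real.cosh (2 * m * x)) + ENNReal.ofReal 1) := fun x => by
    rw [← ENNReal.ofReal_add (Real.cosh_pos _).le zero_le_one,
      ← ENNReal.ofReal_mul (by positivity), gaussianMixtureRatio, mul_pow, ← Real.exp_nat_mul,
      mul_assoc 2 m x, Real.cosh_two_mul, Real.cosh_sq']
    congr 1
    rw [show ((2 : ℕ) : ℝ) * (-(m ^ 2) / 2) = -m ^ 2 by push_cast; ring]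
    ring
  rw [lintegral_congr h, lintegral_const_mul _ (by fun_prop), lintegral_add_left (by fun_prop),
    lintegral_cosh_mul_gaussianReal, lintegral_const, measure_univ, mul_one,
    ← ENNReal.ofReal_add (Real.exp_pos _).le zero_le_one, ← ENNReal.ofReal_mul (by positivity)]
  congr 1
  rw [Real.cosh_eq, div_mul_eq_mul_div, mul_add, ← Real.exp_add]
  ring_nf

/-- A subset `t` encodes the sign pattern that is positive on `t` and negative on `s \ t`. Summing
the densities over all patterns is the binomial expansion of a product of two-term sums. -/
lemma sum_powerset_measure_shift {ι : Type*} [DecidableEq ι] (s : Finset ι) (m : ι → ℝ)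
    {A : Set (ι → ℝ)} (hA : MeasurableSet A) :
    ∑ t ∈ s.powerset, Measure.infinitePi (fun _ : ι => gaussianReal 0 1)
        {ξ | (fun i => (if i ∈ s then (if i ∈ t then m i else -m i) else 0) + ξ i) ∈ A}
      = 2 ^ s.card * ∫⁻ ξ in A, ENNReal.ofReal (∏ i ∈ s, gaussianMixtureRatio (m i) (ξ i))
        ∂Measure.infinitePi (fun _ : ι => gaussianReal 0 1) := by
  have h1 : ∀ t ∈ s.powerset, Measure.infinitePi (fun _ : ι => gaussianReal 0 1)
        {ξ | (fun i => (if i ∈ s then (if i ∈ t then m i else -m i) else 0) + ξ i) ∈ A}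
      = ∫⁻ ξ in A, (∏ i ∈ t, ENNReal.ofReal (Real.exp (m i * ξ i - m i ^ 2 / 2)))
          * (∏ i ∈ s \ t, ENNReal.ofReal (Real.exp (-m i * ξ i - (-m i) ^ 2 / 2)))
        ∂Measure.infinitePi (fun _ : ι => gaussianReal 0 1) := by
    intro t ht
    have hts := Finset.mem_powerset.1 ht
    have := infinitePi_gaussianReal_map_add s
      (fun i => if i ∈ s then (if i ∈ t then m i else -m i) else 0)
      (fun i hi => by simp only [hi, if_false])
    have h2 := congrArg (fun ν => ν A) this
    simp only at h2
    rw [Measure.map_apply (by fun_prop) hA, withDensity_apply _ hA] at h2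
    refine Eq.trans h2 (lintegral_congr fun ξ => ?_)
    rw [← Finset.prod_sdiff hts, mul_comm]
    congr 1
    · exact Finset.prod_congr rfl fun i hi => by simp only [hi, hts hi, if_true]
    · refine Finset.prod_congr rfl fun i hi => ?_
      obtain ⟨h3, h4⟩ := Finset.mem_sdiff.1 hi
      simp only [h3, h4, if_true, if_false]
  rw [Finset.sum_congr rfl h1, ← lintegral_finsetSum _ (fun t _ => by fun_prop),
    ← lintegral_const_mul _ (by fun_prop)]
  refine lintegral_congr fun ξ => ?_
  rw [← Finset.prod_add, Finset.prod_congr rfl fun i _ => ofReal_exp_add_ofReal_exp (m i) (ξ i),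
    Finset.prod_mul_distrib, Finset.prod_const,
    ENNReal.ofReal_prod_of_nonneg fun i _ => gaussianMixtureRatio_nonneg _ _]

/-- Le Cam's bound: if `G` is a probability density with respect to `μ` with second moment at most
`M`, then the sum of the errors of any test of `μ` against `G • μ` is bounded below. -/
lemma measureReal_sub_setIntegral_le {Ω : Type*} [MeasurableSpace Ω] (μ : Measure Ω)
    [IsProbabilityMeasure μ] {G : Ω → ℝ} (hG : Integrable G μ) (hG1 : ∫ x, G x ∂μ = 1)
    (hG2 : Integrable (fun x => G x ^ 2) μ) {M : ℝ} (hM : ∫ x, G x ^ 2 ∂μ ≤ M)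
    {A : Set Ω} (hA : MeasurableSet A) {η : ℝ} (hη : 0 < η) :
    μ.real A - ∫ x in A, G x ∂μ ≤ (M - 1) / (8 * η) + η / 2 := by
  -- Both `1 - G` and `0` are at most `|1 - G| / 2 + (1 - G) / 2`, whose last term integrates to
  -- zero, and `|1 - G| ≤ (1 - G)² / (4η) + η`.
  have hpt : ∀ x, A.indicator (fun _ => (1 : ℝ)) x - A.indicator G x
      ≤ (8 * η)⁻¹ * (G x ^ 2 - 2 * G x + 1) + η / 2 + (1 - G x) / 2 := by
    intro x
    have h1 : (8 * η)⁻¹ * (G x ^ 2 - 2 * G x + 1) + η / 2 - (1 - G x) / 2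
        = (8 * η)⁻¹ * (1 - G x - 2 * η) ^ 2 := by field_simp; ring
    have h2 : (8 * η)⁻¹ * (G x ^ 2 - 2 * G x + 1) + η / 2 + (1 - G x) / 2
        = (8 * η)⁻¹ * (1 - G x + 2 * η) ^ 2 := by field_simp; ring
    have h3 : 0 ≤ (8 * η)⁻¹ * (1 - G x - 2 * η) ^ 2 := by positivity
    have h4 : 0 ≤ (8 * η)⁻¹ * (1 - G x + 2 * η) ^ 2 := by positivity
    by_cases hx : x ∈ A
    · rw [Set.indicator_of_mem hx, Set.indicator_of_mem hx]; linarith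
    · rw [Set.indicator_of_notMem hx, Set.indicator_of_notMem hx]; linarith
  have hi1 : Integrable (A.indicator (fun _ => (1 : ℝ))) μ := (integrable_const 1).indicator hA
  have hi2 : Integrable (A.indicator G) μ := hG.indicator hA
  have hi3 : Integrable (fun x => G x ^ 2 - 2 * G x + 1) μ := by fun_prop
  have hi4 : Integrable (fun x => (1 - G x) / 2) μ := by fun_prop
  have hint := integral_mono (hi1.sub hi2)
    (((hi3.const_mul (8 * η)⁻¹).add (integrable_const (η / 2))).add hi4) hpt
  have e1 : ∫ x, (A.indicator (fun _ => (1 : ℝ)) - A.indicator G) x ∂μ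
      = μ.real A - ∫ x in A, G x ∂μ := by
    rw [integral_sub' hi1 hi2, integral_indicator hA, integral_indicator hA]
    simp
  have e3 : ∫ x, (G x ^ 2 - 2 * G x + 1) ∂μ = ∫ x, G x ^ 2 ∂μ - 1 := by
    rw [integral_add (by fun_prop) (integrable_const _), integral_sub hG2 (hG.const_mul 2),
      integral_const_mul, hG1, integral_const]
    simp; ring
  have e4 : ∫ x, (1 - G x) / 2 ∂μ = 0 := by
    rw [integral_div, integral_sub (integrable_const _) hG, hG1]; simp
  have e2 : ∫ x, ((8 * η)⁻¹ * (G x ^ 2 - 2 * G x + 1) + η / 2 + (1 - G x) / 2) ∂μ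
      = (8 * η)⁻¹ * (∫ x, G x ^ 2 ∂μ - 1) + η / 2 := by
    rw [integral_add (by fun_prop) hi4, integral_add (hi3.const_mul _) (integrable_const _),
      integral_const_mul, e3, e4]
    simp
  have hint' : ∫ x, (A.indicator (fun _ => (1 : ℝ)) - A.indicator G) x ∂μ
    ≤ ∫ x, ((8 * η)⁻¹ * (G x ^ 2 - 2 * G x + 1) + η / 2 + (1 - G x) / 2) ∂μ := hint
  rw [e1, e2] at hint'
  refine hint'.trans ?_
  have : (8 * η)⁻¹ * (∫ x, G x ^ 2 ∂μ - 1) ≤ (8 * η)⁻¹ * (M - 1) := by gcongr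
  rw [div_eq_inv_mul (M - 1)]
  linarith

lemma integrable_and_integral_eq_of_lintegral_ofReal {Ω : Type*} [MeasurableSpace Ω]
    {μ : Measure Ω} {f : Ω → ℝ} (hf : Measurable f) (hf0 : ∀ x, 0 ≤ f x) {c : ℝ} (hc : 0 ≤ c)
    (h : ∫⁻ x, ENNReal.ofReal (f x) ∂μ = ENNReal.ofReal c) :
    Integrable f μ ∧ ∫ x, f x ∂μ = c := by
  refine ⟨(lintegral_ofReal_ne_top_iff_integrable hf.aestronglyMeasurable
    (Eventually.of_forall hf0)).1 (h ▸ ENNReal.ofReal_ne_top), ?_⟩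
  rw [integral_eq_lintegral_of_nonneg_ae (Eventually.of_forall hf0) hf.aestronglyMeasurable, h,
    ENNReal.toReal_ofReal hc]

/-- Average of the shifted product Gaussian measures over all sign patterns of the shift: if the
standard Gaussian measure of `Aᶜ` is at most `α` and all the shifted measures of `A` are at most
`β`, then the shift is not too small. -/
lemma one_add_sq_le_exp_of_forall_sign {ι : Type*} [DecidableEq ι] (s : Finset ι) (m : ι → ℝ)
    {A : Set (ι → ℝ)} (hA : MeasurableSet A) {α β : ℝ} (hα : 0 ≤ α) (hβ : 0 ≤ β)
    (hαβ : α + β < 1)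
    (h0 : Measure.infinitePi (fun _ : ι => gaussianReal 0 1) Aᶜ ≤ ENNReal.ofReal α)
    (h1 : ∀ t ⊆ s, Measure.infinitePi (fun _ : ι => gaussianReal 0 1)
        {ξ | (fun i => (if i ∈ s then (if i ∈ t then m i else -m i) else 0) + ξ i) ∈ A}
      ≤ ENNReal.ofReal β) :
    1 + 4 * (1 - α - β) ^ 2 ≤ Real.exp ((∑ i ∈ s, m i ^ 4) / 2) := by
  set γ := Measure.infinitePi (fun _ : ι => gaussianReal 0 1) with hγ
  let G : (ι → ℝ) → ℝ := fun ξ => ∏ i ∈ s, gaussianMixtureRatio (m i) (ξ i)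
  have hGm : Measurable G := by fun_prop
  have hG0 : ∀ ξ, 0 ≤ G ξ := fun ξ => Finset.prod_nonneg fun i _ => gaussianMixtureRatio_nonneg _ _
  obtain ⟨hGi, hG1⟩ := integrable_and_integral_eq_of_lintegral_ofReal (μ := γ) hGm hG0 zero_le_one
    (by
      simp only [G, ENNReal.ofReal_prod_of_nonneg fun i _ => gaussianMixtureRatio_nonneg _ _]
      rw [lintegral_finset_prod_infinitePi _ s
        (f := fun i x => ENNReal.ofReal (gaussianMixtureRatio (m i) x)) (fun i => by fun_prop)]
      simp only [lintegral_gaussianMixtureRatio, Finset.prod_const_one, ENNReal.ofReal_one])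
  obtain ⟨hG2i, hG2⟩ := integrable_and_integral_eq_of_lintegral_ofReal (μ := γ)
    (f := fun ξ => G ξ ^ 2) (by fun_prop) (fun ξ => sq_nonneg _)
    (c := ∏ i ∈ s, Real.cosh (m i ^ 2)) (Finset.prod_nonneg fun i _ => (Real.cosh_pos _).le)
    (by
      simp only [G, ← Finset.prod_pow, ENNReal.ofReal_prod_of_nonneg
        fun i _ => sq_nonneg (gaussianMixtureRatio _ _)]
      rw [lintegral_finset_prod_infinitePi _ s
        (f := fun i x => ENNReal.ofReal (gaussianMixtureRatio (m i) x ^ 2)) (fun i => by fun_prop)]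
      simp only [lintegral_gaussianMixtureRatio_sq]
      rw [ENNReal.ofReal_prod_of_nonneg fun i _ => (Real.cosh_pos _).le])
  have hM : ∫ ξ, G ξ ^ 2 ∂γ ≤ Real.exp ((∑ i ∈ s, m i ^ 4) / 2) := by
    rw [hG2, Finset.sum_div, Real.exp_sum]
    refine Finset.prod_le_prod (fun i _ => (Real.cosh_pos _).le) fun i _ => ?_
    refine (Real.cosh_le_exp_half_sq _).trans_eq ?_
    ring_nf
  have hA0 : 1 - α ≤ γ.real A := by
    have h2 : γ.real Aᶜ ≤ α := ENNReal.toReal_le_of_le_ofReal hα h0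
    rw [probReal_compl_eq_one_sub hA] at h2
    linarith
  have hA1 : ∫ ξ in A, G ξ ∂γ ≤ β := by
    -- The mixture error is the average over the `2 ^ s.card` patterns, so it is also at most `β`.
    have h2 := Finset.sum_le_card_nsmul _ _ _ fun t ht => h1 t (Finset.mem_powerset.1 ht)
    rw [sum_powerset_measure_shift s m hA, Finset.card_powerset, nsmul_eq_mul, Nat.cast_pow,
      Nat.cast_ofNat] at h2
    have h3 := (ENNReal.mul_le_mul_iff_right (by simp) (by simp)).1 h2
    rw [integral_eq_lintegral_of_nonneg_ae (Eventually.of_forall hG0) hGm.aestronglyMeasurable]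
    exact ENNReal.toReal_le_of_le_ofReal hβ h3
  have hη : 0 < 1 - α - β := by linarith
  -- Taking `η = 1 - α - β` makes `η / 2` half of the left side, which yields the factor 4.
  have key := measureReal_sub_setIntegral_le γ hGi hG1 hG2i hM hA hη
  have h4 : (1 - α - β) / 2 ≤ (Real.exp ((∑ i ∈ s, m i ^ 4) / 2) - 1) / (8 * (1 - α - β)) := by
    linarith
  rw [le_div_iff₀ (by positivity)] at h4
  nlinarith

/-! ### The lower bound. -/

namespace GaussianSequence

lemma le_sq_of_secondKindError_le (a b : ℕ+ → ℝ) (ha : ∀ j, 0 < a j) (ha_mono : Monotone a)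
    (hb : ∀ j, 0 < b j) {α β : ℝ} (hα : α ∈ Set.Ioo (0 : ℝ) 1) (hβ : β ∈ Set.Ioo (0 : ℝ) 1)
    (hαβ : α + β ≤ 1) {ε : ℝ} (hε : 0 < ε) (D : ℕ+) {Ψ : (ℕ+ → ℝ) → Fin 2}
    (hΨ : IsLevelTest b ε α Ψ) {r : ℝ} (hr : 0 < r)
    (hpow : secondKindError b ε (alternative a r) Ψ ≤ ENNReal.ofReal β) :
    min (lowerConst α β ^ 2 * ε ^ 2 * √(∑ j ∈ Finset.Icc 1 D, ((b j) ^ 4)⁻¹)) ((a D) ^ 2)⁻¹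
      ≤ r ^ 2 := by
  by_contra hlt
  obtain ⟨hr1, hr2⟩ := lt_min_iff.1 (not_le.1 hlt)
  set I := Finset.Icc 1 D with hI
  set B := ∑ j ∈ I, ((b j) ^ 4)⁻¹ with hB
  have hBpos : 0 < B := Finset.sum_pos (fun j _ => by have := hb j; positivity)
    ⟨1, Finset.mem_Icc.2 ⟨le_rfl, one_le⟩⟩
  have hB2 : √B ^ 2 = B := Real.sq_sqrt hBpos.le
  have hlog0 : 0 ≤ Real.log (1 + 4 * (1 - α - β) ^ 2) :=
    Real.log_nonneg (by nlinarith [sq_nonneg (1 - α - β)])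
  have hc4 : (lowerConst α β ^ 2) ^ 2 = 2 * Real.log (1 + 4 * (1 - α - β) ^ 2) := by
    rw [← pow_mul, lowerConst, ← Real.rpow_natCast, ← Real.rpow_mul (by positivity)]
    norm_num
  -- Moduli proportional to `b_j⁻²` minimise `∑ (b_j v_j)⁴` subject to `∑ v_j² = r²`: the least
  -- detectable choice.
  let v : ℕ+ → ℝ := fun j => r / (√B * b j ^ 2)
  let m : ℕ+ → ℝ := fun j => b j * v j / ε
  have hm4 : ∑ j ∈ I, m j ^ 4 = (r ^ 2 / (ε ^ 2 * √B)) ^ 2 := by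
    have : ∀ j ∈ I, m j ^ 4 = r ^ 4 / (ε ^ 4 * (√B ^ 2) ^ 2) * ((b j) ^ 4)⁻¹ := fun j _ => by
      have := (hb j).ne'
      simp only [m, v]; field_simp
    rw [Finset.sum_congr rfl this, ← Finset.mul_sum, hB2, ← hB]
    have e : (r ^ 2 / (ε ^ 2 * √B)) ^ 2 = r ^ 4 / (ε ^ 4 * √B ^ 2) := by ring
    rw [e, hB2]; field_simp
  have hm4lt : ∑ j ∈ I, m j ^ 4 < 2 * Real.log (1 + 4 * (1 - α - β) ^ 2) := by
    rw [hm4, ← hc4]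
    refine pow_lt_pow_left₀ ?_ (by positivity) two_ne_zero
    rw [div_lt_iff₀ (by positivity), ← mul_assoc]
    exact hr1
  -- When `α + β = 1` the logarithm vanishes, and `hm4lt` would make a sum of fourth powers
  -- negative.
  have hαβ' : α + β < 1 := by
    refine lt_of_le_of_ne hαβ fun h => ?_
    have h0 : 1 - α - β = 0 := by linarith
    rw [h0] at hm4lt
    have : 0 ≤ ∑ j ∈ I, m j ^ 4 := Finset.sum_nonneg fun j _ => by positivity
    simp at hm4lt
    linarith
  let w : Finset ℕ+ → ℕ+ → ℝ := fun t j => if j ∈ I then (if j ∈ t then v j else -v j) else 0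
  have hw_mem : ∀ t j, j ∈ I → w t j ^ 2 = v j ^ 2 := fun t j hj => by
    by_cases ht : j ∈ t <;> simp only [w, hj, ht, if_true, if_false, neg_sq]
  have hw_notMem : ∀ t j, j ∉ I → w t j = 0 := fun t j hj => by simp only [w, hj, if_false]
  have hsum : ∀ (t : Finset ℕ+) (f : ℕ+ → ℝ),
      HasSum (fun j => f j * w t j ^ 2) (∑ j ∈ I, f j * v j ^ 2) := by
    intro t f
    have := hasSum_sum_of_ne_finset_zero (f := fun j => f j * w t j ^ 2) (s := I)
      (L := SummationFilter.unconditional _)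
      (fun j hj => by rw [hw_notMem t j hj]; ring)
    rwa [Finset.sum_congr rfl (g := fun j => f j * v j ^ 2)
      (fun j hj => by rw [hw_mem t j hj])] at this
  have hv2 : ∑ j ∈ I, v j ^ 2 = r ^ 2 := by
    have : ∀ j ∈ I, v j ^ 2 = r ^ 2 / √B ^ 2 * ((b j) ^ 4)⁻¹ := fun j _ => by
      have := (hb j).ne'
      simp only [v]; field_simp
    rw [Finset.sum_congr rfl this, ← Finset.mul_sum, hB2, ← hB]
    field_simp
  have hmemlp : ∀ t, Memℓp (w t) 2 := fun t => by
    refine memℓp_gen ?_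
    have := (hsum t 1).summable
    simpa using this
  let θ : Finset ℕ+ → ℓ²(ℕ+, ℝ) := fun t => ⟨w t, hmemlp t⟩
  have hθ : ∀ t j, θ t j = w t j := fun t j => rfl
  have halt : ∀ t, θ t ∈ alternative a r := by
    intro t
    refine ⟨⟨(hsum t (fun j => a j ^ 2)).summable, ?_⟩, ?_⟩
    · have e : ∑' j, a j ^ 2 * θ t j ^ 2 = ∑ j ∈ I, a j ^ 2 * v j ^ 2 :=
        (hsum t (fun j => a j ^ 2)).tsum_eq
      rw [e]
      have haD := ha D
      calc ∑ j ∈ I, a j ^ 2 * v j ^ 2 ≤ ∑ j ∈ I, a D ^ 2 * v j ^ 2 := by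
            gcongr with j hj
            · exact (ha j).le
            · exact ha_mono (Finset.mem_Icc.1 hj).2
        _ = a D ^ 2 * r ^ 2 := by rw [← Finset.mul_sum, hv2]
        _ ≤ a D ^ 2 * (a D ^ 2)⁻¹ := by gcongr
        _ = 1 := mul_inv_cancel₀ (by positivity)
    · have h1 : HasSum (fun j => θ t j ^ 2) (r ^ 2) := by
        have := hsum t 1
        simpa [hv2, hθ] using this
      have h2 := (hasSum_sq_norm_sq (θ t)).unique h1
      exact ((sq_eq_sq₀ (norm_nonneg _) hr.le).1 h2).ge
  -- The acceptance region in the whitened coordinates `Y / ε`.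
  let A : Set (ℕ+ → ℝ) := {ξ | Ψ (fun j => ε * ξ j) = 0}
  have hΨ0 : MeasurableSet {y | Ψ y = 0} := hΨ.1 (measurableSet_singleton 0)
  have hΨ1 : MeasurableSet {y | Ψ y = 1} := hΨ.1 (measurableSet_singleton 1)
  have hA : MeasurableSet A :=
    (by fun_prop : Measurable (fun (ξ : ℕ+ → ℝ) (j : ℕ+) => ε * ξ j)) hΨ0
  have hfirst : Measure.infinitePi (fun _ : ℕ+ => gaussianReal 0 1) Aᶜ ≤ ENNReal.ofReal α := by
    have h := hΨ.2
    rw [firstKindError, law_apply b ε 0 hΨ1] at h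
    refine (measure_mono fun ξ hξ => ?_).trans h
    have hξ' : ¬ Ψ (fun j => ε * ξ j) = 0 := hξ
    change Ψ (fun j => b j * (0 : ℓ²(ℕ+, ℝ)) j + ε * ξ j) = 1
    have e : (fun j => b j * (0 : ℓ²(ℕ+, ℝ)) j + ε * ξ j) = fun j => ε * ξ j := by
      funext j; simp
    rw [e]
    omega
  have hsecond : ∀ t ⊆ I, Measure.infinitePi (fun _ : ℕ+ => gaussianReal 0 1)
      {ξ | (fun j => (if j ∈ I then (if j ∈ t then m j else -m j) else 0) + ξ j) ∈ A}
      ≤ ENNReal.ofReal β := by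
    intro t _
    have h := (le_iSup₂ (f := fun θ (_ : θ ∈ alternative a r) => law b ε θ {y | Ψ y = 0})
      (θ t) (halt t)).trans hpow
    rw [law_apply b ε (θ t) hΨ0] at h
    refine (measure_mono fun ξ hξ => ?_).trans h
    have hξ' : Ψ (fun j => ε * ((if j ∈ I then (if j ∈ t then m j else -m j) else 0) + ξ j)) = 0 :=
      hξ
    change Ψ (fun j => b j * θ t j + ε * ξ j) = 0
    rw [← hξ']
    congr 1
    funext j
    simp only [hθ, w, m]
    split_ifs <;> field_simp
    simp
  have key := one_add_sq_le_exp_of_forall_sign I m hA hα.1.le hβ.1.le hαβ' hfirst hsecond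
  have hpos : 0 < 1 + 4 * (1 - α - β) ^ 2 := by positivity
  rw [← Real.log_le_iff_le_exp hpos] at key
  linarith

lemma le_minimaxRadius_sq (a b : ℕ+ → ℝ) (ha : ∀ j, 0 < a j) (ha_mono : Monotone a)
    (hb : ∀ j, 0 < b j) {α β : ℝ} (hα : α ∈ Set.Ioo (0 : ℝ) 1) (hβ : β ∈ Set.Ioo (0 : ℝ) 1)
    (hαβ : α + β ≤ 1) {ε : ℝ} (hε : 0 < ε) (D : ℕ+) :
    ENNReal.ofReal (min (lowerConst α β ^ 2 * ε ^ 2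
        * √(∑ j ∈ Finset.Icc 1 D, ((b j) ^ 4)⁻¹)) ((a D) ^ 2)⁻¹)
      ≤ minimaxRadius a b ε α β ^ 2 := by
  set M := min (lowerConst α β ^ 2 * ε ^ 2 * √(∑ j ∈ Finset.Icc 1 D, ((b j) ^ 4)⁻¹))
    ((a D) ^ 2)⁻¹ with hM
  have hM0 : 0 ≤ M := le_min (by positivity) (by positivity)
  have h : ENNReal.ofReal √M ≤ minimaxRadius a b ε α β := by
    refine le_iInf₂ fun Ψ hΨ => le_iInf₂ fun r hr => le_iInf fun hpow => ?_
    refine ENNReal.ofReal_le_ofReal (Real.sqrt_le_iff.2 ⟨hr.le, ?_⟩)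
    exact le_sq_of_secondKindError_le a b ha ha_mono hb hα hβ hαβ hε D hΨ hr hpow
  calc ENNReal.ofReal M = ENNReal.ofReal √M ^ 2 := by
        rw [← ENNReal.ofReal_pow (Real.sqrt_nonneg _), Real.sq_sqrt hM0]
    _ ≤ minimaxRadius a b ε α β ^ 2 := by gcongr

end GaussianSequence

theorem theorem1 (a b : ℕ+ → ℝ) (ha : ∀ j, 0 < a j) (ha_mono : Monotone a)
    (ha_lim : Tendsto a atTop atTop) (hb : ∀ j, 0 < b j)
    (α β : ℝ) (hα : α ∈ Set.Ioo (0 : ℝ) 1) (hβ : β ∈ Set.Ioo (0 : ℝ) 1)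
    (ε : ℝ) (hε : 0 < ε) :
    (α + β ≤ 1 →
      (⨆ D : ℕ+, ENNReal.ofReal
          (min (GaussianSequence.lowerConst α β ^ 2 * ε ^ 2
              * √(∑ j ∈ Finset.Icc 1 D, ((b j) ^ 4)⁻¹)) ((a D) ^ 2)⁻¹))
        ≤ GaussianSequence.minimaxRadius a b ε α β ^ 2) ∧
    GaussianSequence.minimaxRadius a b ε α β ^ 2
      ≤ (⨅ D : ℕ+, ENNReal.ofReal
          (GaussianSequence.upperConst α β ^ 2 * ε ^ 2
              * √(∑ j ∈ Finset.Icc 1 D, ((b j) ^ 4)⁻¹) + ((a D) ^ 2)⁻¹)) := by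
  exact ⟨fun hαβ => iSup_le fun D =>
      GaussianSequence.le_minimaxRadius_sq a b ha ha_mono hb hα hβ hαβ hε D,
    le_iInf fun D => GaussianSequence.minimaxRadius_sq_le a b ha ha_mono hb hα hβ hε D⟩
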